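/- An $r$-graph is an $r$-uniform hypergraph: a vertex set together with a set of edges, each consisting of exactly $r$ distinct vertices. A complete linear $r$-graph (also called a Steiner system) is an $r$-graph in which every pair of distinct vertices belongs to exactly one edge. **Theorem.** For every integer $c\ge 0$ there exists $r_0=r_0(c)$ such that for every integer $r\ge r_0$ and every integer $k\ge 3$ there exists $n_0=n_0(c,r,k)$ with the following property. For every complete linear $r$-graph $\mathcal G$ on a finite set of $n>n_0$ vertices and every colouring of the edges of $\mathcal G$ with $c$ colours, there are $k$ distinct edges of $\mathcal G$, all of the same colour, whose union contains at most $(r-2)k+3$ vertices. -/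

import Mathlib

open scoped Hypergraph

namespace Hypergraph

variable {α : Type*}

/-- `H` is an `r`-uniform hypergraph (`r`-graph): every edge consists of exactly `r` distinct
vertices. -/
def IsUniform (H : Hypergraph α) (r : ℕ) : Prop :=
  ∀ e ∈ E(H), e.encard = r

/-- A hypergraph is linear if every pair of distinct vertices belongs to at most one edge. -/
def IsLinear (H : Hypergraph α) : Prop :=
  ∀ u ∈ V(H), ∀ v ∈ V(H), u ≠ v → ∀ e ∈ E(H), ∀ f ∈ E(H),
    u ∈ e → v ∈ e → u ∈ f → v ∈ f → e = f

/-- A complete linear `r`-graph (Steiner system): a linear `r`-graph in which every pair of distinct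
vertices belongs to exactly one edge. -/
def IsCompleteLinear (H : Hypergraph α) (r : ℕ) : Prop :=
  H.IsUniform r ∧ H.IsLinear ∧
    ∀ u ∈ V(H), ∀ v ∈ V(H), u ≠ v → ∃! e : Set α, e ∈ E(H) ∧ u ∈ e ∧ v ∈ e

/-- A `(v, k)`-configuration in `H`: a set `F` of exactly `k` edges of `H` spanned by at most `v`
vertices, that is, the union of the edges in `F` has at most `v` elements. -/
def IsConfiguration (H : Hypergraph α) (v k : ℕ) (F : Set (Set α)) : Prop :=
  F ⊆ E(H) ∧ F.encard = k ∧ (⋃₀ F).encard ≤ v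

/-- With respect to a `c`-colouring `χ` of the edges of `H`, all the edges of `H` in `F` have the same
colour. -/
def IsMonochromatic (H : Hypergraph α) {c : ℕ} (χ : E(H) → Fin c) (F : Set (Set α)) : Prop :=
  ∃ i : Fin c, ∀ e : E(H), (e : Set α) ∈ F → χ e = i

end Hypergraph

/-!
Call an ordered pair of meeting edges a cherry and an ordered triple of pairwise meeting edges
without a common vertex a triangle; let `n` be the number of vertices. The proof compares the numbers
of monochromatic triangles and cherries.

*Many triangles.* By Ramsey's theorem, boundedly many points of which no three are collinear contain
three points whose connecting edges have the same colour. Sampling such point sets shows that, for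
large `n`, some colour class has at least `n ^ 3 / N` triangles, where `N` depends only on `c`
(`exists_colour_many_triangles`). On the other hand a linear `r`-graph has at most
`n ^ 3 / (r - 1) ^ 2` cherries (`card_cherries_mul_le`).

*Few triangles per cherry.* Fix this colour class and suppose that no `k` of its edges span at most
`(r - 2) * k + 3` vertices. Call the three pairs of edges of a triangle equivalent, and consider the
generated equivalence classes of cherries. The edges of a class can be listed starting with a cherry
such that every further edge closes a triangle with two earlier ones, hence meets the earlier edges in
at least two vertices. So every initial segment with `j ≥ 2` edges spans at most `(r - 2) * j + 3`
vertices, and a class has fewer than `k` edges. Consider the excess: the number of vertices minus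
`r - 2` times the number of edges.

* If the excess of the whole class is positive, then every edge met the earlier ones in at most `4`
  vertices. As a triangle is determined by a cherry together with two points on its edges, the class
  has at most `6 * r` times as many triangles as cherries (`Built.card_trianglesIn_le`).
* Classes of excess at most `0` with disjoint edge sets can be concatenated, with the excess of all
  initial segments staying at most `3`. So there is a set of fewer than `k` edges that all these
  classes meet, and they contribute only `O(n ^ 2)` triangles for fixed `k`.

Hence there are at most `6 * r * n ^ 3 / (r - 1) ^ 2 + O(n ^ 2)` triangles (`card_triangles_le`),
fewer than `n ^ 3 / N` if `r` is large in terms of `N` and `n` is large in terms of `r` and `k`.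
-/

namespace BrownErdosSos

open Finset

/-! ### Cherries and triangles -/

variable {V : Type*} [DecidableEq V]

/-- Every edge in `E` has exactly `r` vertices. -/
def Uniform (E : Finset (Finset V)) (r : ℕ) : Prop := ∀ e ∈ E, #e = r

/-- Two distinct edges in `E` share at most one vertex. -/
def Linear (E : Finset (Finset V)) : Prop :=
  ∀ e ∈ E, ∀ f ∈ E, ∀ x ∈ e, ∀ y ∈ e, x ∈ f → y ∈ f → x ≠ y → e = f

/-- A cherry is an ordered pair of distinct edges which meet. -/
def IsCherry (E : Finset (Finset V)) (e f : Finset V) : Prop :=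
  e ∈ E ∧ f ∈ E ∧ e ≠ f ∧ (e ∩ f).Nonempty

/-- A triangle is an ordered triple of edges which meet pairwise and have no common vertex. The
edges are then automatically distinct. -/
structure IsTriangle (E : Finset (Finset V)) (e f g : Finset V) : Prop where
  mem₁ : e ∈ E
  mem₂ : f ∈ E
  mem₃ : g ∈ E
  meet₁₂ : (e ∩ f).Nonempty
  meet₁₃ : (e ∩ g).Nonempty
  meet₂₃ : (f ∩ g).Nonempty
  inter_eq_empty : e ∩ f ∩ g = ∅

namespace IsTriangle

variable {E : Finset (Finset V)} {e f g : Finset V}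

lemma swap₁₂ (h : IsTriangle E e f g) : IsTriangle E f e g :=
  ⟨h.mem₂, h.mem₁, h.mem₃, by simpa [inter_comm] using h.meet₁₂, h.meet₂₃, h.meet₁₃, by
    simpa [inter_comm] using h.inter_eq_empty⟩

lemma swap₂₃ (h : IsTriangle E e f g) : IsTriangle E e g f :=
  ⟨h.mem₁, h.mem₃, h.mem₂, h.meet₁₃, h.meet₁₂, by simpa [inter_comm] using h.meet₂₃, by
    rw [inter_right_comm]; exact h.inter_eq_empty⟩

lemma ne₁₂ (h : IsTriangle E e f g) : e ≠ f := by
  rintro rfl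
  have h1 := h.inter_eq_empty
  rw [inter_self] at h1
  exact h.meet₁₃.ne_empty h1

lemma ne₁₃ (h : IsTriangle E e f g) : e ≠ g := h.swap₂₃.ne₁₂

lemma ne₂₃ (h : IsTriangle E e f g) : f ≠ g := h.swap₁₂.ne₁₃

lemma isCherry₁₂ (h : IsTriangle E e f g) : IsCherry E e f :=
  ⟨h.mem₁, h.mem₂, h.ne₁₂, h.meet₁₂⟩

lemma isCherry₁₃ (h : IsTriangle E e f g) : IsCherry E e g := h.swap₂₃.isCherry₁₂

lemma notMem (h : IsTriangle E e f g) {x : V} (he : x ∈ e) (hf : x ∈ f) : x ∉ g := by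
  intro hg
  have : x ∈ e ∩ f ∩ g := by simp [he, hf, hg]
  rw [h.inter_eq_empty] at this
  simp at this

end IsTriangle

lemma IsCherry.symm {E : Finset (Finset V)} {e f : Finset V} (h : IsCherry E e f) :
    IsCherry E f e :=
  ⟨h.2.1, h.1, h.2.2.1.symm, by simpa [inter_comm] using h.2.2.2⟩

/-- The vertices spanned by a set of edges. -/
abbrev vertexSpan (F : Finset (Finset V)) : Finset V := F.biUnion id

/-- For every `j` up to its size, `F` contains `j` edges spanning at most `(r - 2) * j + 3`
vertices. -/
def HasSparsePrefixes (r : ℕ) (F : Finset (Finset V)) : Prop :=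
  ∀ j ≤ #F, ∃ F' ⊆ F, #F' = j ∧ #(vertexSpan F') ≤ (r - 2) * j + 3

/-! ### Triangle-connected classes of cherries -/

/-- `q` arises from the pair `p` by swapping it, or by replacing its second edge with the third edge
of a triangle on `p`. These steps connect all six ordered cherries of a triangle. -/
def TriangleStep (E : Finset (Finset V)) (p q : Finset V × Finset V) : Prop :=
  q = (p.2, p.1) ∨ ∃ g, IsTriangle E p.1 p.2 g ∧ q = (p.1, g)

/-- The classes of cherries under the equivalence generated by `TriangleStep`. As `TriangleStep` is
a relation on all pairs of sets, pairs which are not cherries also have a class; it contains no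
cherry. -/
abbrev CherryClass (E : Finset (Finset V)) := Quotient (Relation.EqvGen.setoid (TriangleStep E))

/-- The class of the pair `(e, f)`. -/
def cherryClass (E : Finset (Finset V)) (e f : Finset V) : CherryClass E :=
  Quotient.mk _ (e, f)

lemma cherryClass_comm (E : Finset (Finset V)) (e f : Finset V) :
    cherryClass E e f = cherryClass E f e :=
  Quotient.sound (Relation.EqvGen.rel _ _ (Or.inl rfl))

lemma IsTriangle.cherryClass_eq {E : Finset (Finset V)} {e f g : Finset V}
    (h : IsTriangle E e f g) : cherryClass E e f = cherryClass E e g :=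
  Quotient.sound (Relation.EqvGen.rel _ _ (Or.inr ⟨g, h, rfl⟩))

lemma TriangleStep.symm {E : Finset (Finset V)} {p q : Finset V × Finset V}
    (h : TriangleStep E p q) : TriangleStep E q p := by
  rcases h with rfl | ⟨g, hg, rfl⟩
  · exact Or.inl rfl
  · exact Or.inr ⟨p.2, hg.swap₂₃, rfl⟩

/-- A set of pairs closed under `TriangleStep` is a union of classes. -/
lemma mem_of_cherryClass_eq {E : Finset (Finset V)} {S : Finset V × Finset V → Prop}
    (hS : ∀ p q, S p → TriangleStep E p q → S q) {e f e' f' : Finset V}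
    (h : cherryClass E e f = cherryClass E e' f') (hef : S (e, f)) : S (e', f') := by
  have h1 : Relation.EqvGen (TriangleStep E) (e, f) (e', f') := Quotient.exact h
  have key : ∀ p q, Relation.EqvGen (TriangleStep E) p q → (S p ↔ S q) := by
    intro p q h
    induction h with
    | rel p q h => exact ⟨fun hp => hS _ _ hp h, fun hq => hS _ _ hq h.symm⟩
    | refl => rfl
    | symm _ _ _ ih => exact ih.symm
    | trans _ _ _ _ _ ih ih' => exact ih.trans ih'
  exact (key _ _ h1).1 hef

/-- `Built E q F`: the edge set `F` arises from a cherry of class `q` by repeatedly adding the third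
edge of a triangle that has two edges in `F` forming a cherry of class `q`. Each added edge meets the
span of the earlier ones in at least two vertices. -/
inductive Built (E : Finset (Finset V)) (q : CherryClass E) : Finset (Finset V) → Prop
  | cherry {e f : Finset V} (h : IsCherry E e f) (hq : cherryClass E e f = q) : Built E q {e, f}
  | step {F : Finset (Finset V)} {e f g : Finset V} (hF : Built E q F) (he : e ∈ F) (hf : f ∈ F)
      (hg : g ∉ F) (h : IsTriangle E e f g) (hq : cherryClass E e f = q) : Built E q (insert g F)

open Classical in
/-- The triangles within `F` whose cherries belong to the class `q`. -/
noncomputable def trianglesIn (E : Finset (Finset V)) (q : CherryClass E)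
    (F : Finset (Finset V)) : Finset (Finset V × Finset V × Finset V) :=
  (F ×ˢ F ×ˢ F).filter fun t => IsTriangle E t.1 t.2.1 t.2.2 ∧ cherryClass E t.1 t.2.1 = q

open Classical in
/-- The cherries within `F` that belong to the class `q`. -/
noncomputable def cherriesIn (E : Finset (Finset V)) (q : CherryClass E)
    (F : Finset (Finset V)) : Finset (Finset V × Finset V) :=
  (F ×ˢ F).filter fun t => IsCherry E t.1 t.2 ∧ cherryClass E t.1 t.2 = q

open Classical in
/-- The edges of `F` forming with `g` a cherry of class `q`. -/
noncomputable def cherryPartners (E : Finset (Finset V)) (q : CherryClass E)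
    (F : Finset (Finset V)) (g : Finset V) : Finset (Finset V) :=
  F.filter fun e => IsCherry E e g ∧ cherryClass E e g = q

variable {E : Finset (Finset V)} {r : ℕ} {q : CherryClass E} {F : Finset (Finset V)}

lemma Built.subset (h : Built E q F) : F ⊆ E := by
  induction h with
  | cherry h _ => 
    intro x hx
    simp only [mem_insert, mem_singleton] at hx
    rcases hx with rfl | rfl
    exacts [h.1, h.2.1]
  | step _ _ _ _ h _ ih => exact insert_subset h.mem₃ ih

lemma Built.exists_cherry (h : Built E q F) :
    ∀ e ∈ F, ∃ f, IsCherry E e f ∧ cherryClass E e f = q := by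
  induction h with
  | @cherry e f h hq =>
    intro x hx
    simp only [mem_insert, mem_singleton] at hx
    rcases hx with rfl | rfl
    · exact ⟨f, h, hq⟩
    · exact ⟨e, h.symm, by rw [cherryClass_comm, hq]⟩
  | @step F e f g _ _ _ _ h hq ih =>
    intro x hx
    rcases mem_insert.1 hx with rfl | hx
    · exact ⟨e, h.isCherry₁₃.symm, by rw [cherryClass_comm, ← h.cherryClass_eq, hq]⟩
    · exact ih x hx

lemma card_span_insert (F : Finset (Finset V)) (g : Finset V) :
    #(vertexSpan (insert g F)) + #(g ∩ vertexSpan F) = #(vertexSpan F) + #g := by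
  rw [vertexSpan, biUnion_insert, id, card_union_add_card_inter, add_comm]

lemma IsTriangle.two_le_card_inter_span {e f g : Finset V} (h : IsTriangle E e f g)
    (he : e ∈ F) (hf : f ∈ F) : 2 ≤ #(g ∩ vertexSpan F) := by
  obtain ⟨x, hx⟩ := h.meet₁₃
  obtain ⟨y, hy⟩ := h.meet₂₃
  rw [mem_inter] at hx hy
  have hxy : x ≠ y := by
    rintro rfl
    exact h.notMem hx.1 hy.1 hx.2
  rw [← card_pair hxy]
  refine card_le_card ?_
  intro z hz
  simp only [mem_insert, mem_singleton] at hz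
  rcases hz with rfl | rfl
  · exact mem_inter.2 ⟨hx.2, mem_biUnion.2 ⟨e, he, hx.1⟩⟩
  · exact mem_inter.2 ⟨hy.2, mem_biUnion.2 ⟨f, hf, hy.1⟩⟩

lemma Built.card_span_le (hr : 2 ≤ r) (hu : Uniform E r) (h : Built E q F) :
    #(vertexSpan F) ≤ (r - 2) * #F + 3 := by
  obtain ⟨s, rfl⟩ := Nat.exists_eq_add_of_le' hr
  induction h with
  | @cherry e f h hq =>
    have h1 := card_union_add_card_inter e f
    have h2 := h.2.2.2.card_pos
    rw [hu e h.1, hu f h.2.1] at h1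
    rw [card_pair h.2.2.1]
    have : vertexSpan {e, f} = e ∪ f := by simp [vertexSpan]
    rw [this]
    simp
    omega
  | @step F e f g _ he hf hg h _ ih =>
    have h1 := card_span_insert F g
    have h2 := h.two_le_card_inter_span he hf
    rw [hu g h.mem₃] at h1
    rw [card_insert_of_notMem hg]
    simp only [Nat.add_sub_cancel] at ih ⊢
    linarith

lemma Built.hasSparsePrefixes (hr : 2 ≤ r) (hu : Uniform E r) (h : Built E q F) :
    HasSparsePrefixes r F := by
  have key := h.card_span_le hr hu
  induction h with
  | @cherry e f h hq =>
    intro j hj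
    rw [card_pair h.2.2.1] at hj key
    interval_cases j
    · exact ⟨∅, by simp⟩
    · refine ⟨{e}, by simp, by simp, ?_⟩
      simp [hu e h.1]
      omega
    · exact ⟨{e, f}, Subset.rfl, card_pair h.2.2.1, key⟩
  | @step F e f g hF he hf hg h _ ih =>
    intro j hj
    rcases hj.lt_or_eq with hj | rfl
    · rw [card_insert_of_notMem hg] at hj
      obtain ⟨F', h1, h2⟩ := ih (hF.card_span_le hr hu) j (by omega)
      exact ⟨F', h1.trans (subset_insert _ _), h2⟩
    · exact ⟨_, Subset.rfl, rfl, key⟩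

/-- Adding an edge `g` to `F` creates few triangles: in a new triangle `e, f, g` the edge `e` is a
partner of `g`, and by linearity `f` is determined by the point where it meets `e` and the point of
`g ∩ vertexSpan F` where it meets `g`. The factor `3` accounts for the position of `g` in the ordered
triple. -/
lemma card_trianglesIn_insert (hr : 2 ≤ r) (hu : Uniform E r) (hl : Linear E) {g : Finset V}
    (hg : g ∉ F) :
    #(trianglesIn E q (insert g F)) ≤ #(trianglesIn E q F) +
      3 * (#(cherryPartners E q F g) * (r * #(g ∩ vertexSpan F))) := by
  classical
  set m := cherryPartners E q F g with hm
  set A := (F ×ˢ F).filter fun p => IsTriangle E p.1 p.2 g ∧ cherryClass E p.1 g = q with hA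
  have hAcard : #A ≤ #m * (r * #(g ∩ vertexSpan F)) := by
    have hmaps : ∀ p ∈ A, p.1 ∈ m := by
      intro p hp
      simp only [hA, mem_filter, mem_product] at hp
      simp only [hm, cherryPartners, mem_filter]
      exact ⟨hp.1.1, hp.2.1.isCherry₁₃, hp.2.2⟩
    refine (card_le_mul_card_image_of_maps_to hmaps (r * #(g ∩ vertexSpan F)) ?_).trans_eq (mul_comm _ _)
    intro e he
    have heE : #e = r := hu e (mem_filter.1 he).2.1.1
    rw [← heE, ← card_product]
    have hex : ∀ p ∈ A.filter fun p => p.1 = e, ∃ ab ∈ e ×ˢ (g ∩ vertexSpan F),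
        ab.1 ∈ p.2 ∧ ab.2 ∈ p.2 ∧ ab.1 ≠ ab.2 := by
      intro p hp
      simp only [hA, mem_filter, mem_product] at hp
      obtain ⟨⟨⟨h1, h2⟩, h3, h4⟩, rfl⟩ := hp
      obtain ⟨a, ha⟩ := h3.meet₁₂
      obtain ⟨b, hb⟩ := h3.meet₂₃
      rw [mem_inter] at ha hb
      refine ⟨(a, b), ?_, ha.2, hb.1, ?_⟩
      · simp only [mem_product, mem_inter]
        exact ⟨ha.1, hb.2, mem_biUnion.2 ⟨p.2, h2, hb.1⟩⟩
      · intro hab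
        obtain rfl : a = b := hab
        exact h3.notMem ha.1 ha.2 hb.2
    have : Nonempty (V × V) := by
      obtain ⟨x, -⟩ := card_pos.1 (heE.symm ▸ (by omega : 0 < r))
      exact ⟨(x, x)⟩
    choose! φ hφ using hex
    refine card_le_card_of_injOn φ (fun p hp => (hφ p hp).1) ?_
    intro p hp p' hp' heq
    have h1 := hφ p hp
    have h2 := hφ p' hp'
    rw [heq] at h1
    simp only [hA, coe_filter, mem_filter, mem_product] at hp hp'
    exact Prod.ext (hp.2.trans hp'.2.symm)
      (hl _ hp.1.2.1.mem₂ _ hp'.1.2.1.mem₂ _ h1.2.1 _ h1.2.2.1 h2.2.1 h2.2.2.1 h1.2.2.2)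
  have hsub : trianglesIn E q (insert g F) ⊆ trianglesIn E q F ∪
      (A.image (fun p => (g, p.1, p.2)) ∪ (A.image (fun p => (p.1, g, p.2)) ∪
        A.image (fun p => (p.1, p.2, g)))) := by
    rintro ⟨a, b, d⟩ ht
    simp only [trianglesIn, mem_filter, mem_product, mem_insert] at ht
    obtain ⟨⟨ha, hb, hd⟩, h, hq⟩ := ht
    have h12 := h.ne₁₂
    have h13 := h.ne₁₃
    have h23 := h.ne₂₃
    simp only [mem_union, trianglesIn, mem_filter, mem_product, mem_image, hA, Prod.exists,
      Prod.mk.injEq]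
    rcases ha with rfl | ha
    · refine Or.inr (Or.inl ⟨b, d, ⟨⟨hb.resolve_left h12.symm, hd.resolve_left h13.symm⟩,
        h.swap₁₂.swap₂₃, ?_⟩, rfl, rfl, rfl⟩)
      rw [cherryClass_comm]
      exact hq
    rcases hb with rfl | hb
    · exact Or.inr (Or.inr (Or.inl ⟨a, d, ⟨⟨ha, hd.resolve_left h23.symm⟩,
        h.swap₂₃, hq⟩, rfl, rfl, rfl⟩))
    rcases hd with rfl | hd
    · exact Or.inr (Or.inr (Or.inr ⟨a, b, ⟨⟨ha, hb⟩, h, by rw [← h.cherryClass_eq]; exact hq⟩,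
        rfl, rfl, rfl⟩))
    · exact Or.inl ⟨⟨ha, hb, hd⟩, h, hq⟩
  have h0 := card_le_card hsub
  have h1 := card_union_le (trianglesIn E q F) (A.image (fun p => (g, p.1, p.2)) ∪
    (A.image (fun p => (p.1, g, p.2)) ∪ A.image (fun p => (p.1, p.2, g))))
  have h2 := card_union_le (A.image (fun p => (g, p.1, p.2)))
    (A.image (fun p => (p.1, g, p.2)) ∪ A.image (fun p => (p.1, p.2, g)))
  have h3 := card_union_le (A.image (fun p => (p.1, g, p.2))) (A.image (fun p => (p.1, p.2, g)))
  have h4 : #(A.image (fun p => (g, p.1, p.2))) ≤ #A := card_image_le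
  have h5 : #(A.image (fun p => (p.1, g, p.2))) ≤ #A := card_image_le
  have h6 : #(A.image (fun p => (p.1, p.2, g))) ≤ #A := card_image_le
  omega

lemma card_cherriesIn_insert {g : Finset V} (hg : g ∉ F) :
    #(cherriesIn E q F) + 2 * #(cherryPartners E q F g) ≤
      #(cherriesIn E q (insert g F)) := by
  classical
  set m := cherryPartners E q F g with hm
  have e1 : #(m.image fun e => (e, g)) = #m :=
    card_image_of_injective _ fun a b h => (Prod.mk.inj h).1
  have e2 : #(m.image fun e => (g, e)) = #m :=
    card_image_of_injective _ fun a b h => (Prod.mk.inj h).2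
  have d1 : Disjoint (m.image fun e => (e, g)) (m.image fun e => (g, e)) := by
    rw [disjoint_left]
    rintro ⟨a, b⟩ h1 h2
    simp only [mem_image, Prod.mk.injEq, hm, cherryPartners, mem_filter] at h1 h2
    obtain ⟨x, hx, rfl, rfl⟩ := h1
    obtain ⟨y, hy, rfl, -⟩ := h2
    exact hg hx.1
  have d2 : Disjoint (cherriesIn E q F) ((m.image fun e => (e, g)) ∪ (m.image fun e => (g, e))) := by
    rw [disjoint_left]
    rintro ⟨a, b⟩ h1 h2
    simp only [cherriesIn, mem_filter, mem_product] at h1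
    simp only [mem_union, mem_image, Prod.mk.injEq] at h2
    rcases h2 with ⟨x, -, -, rfl⟩ | ⟨x, -, rfl, -⟩
    exacts [hg h1.1.2, hg h1.1.1]
  have := card_union_of_disjoint d2
  rw [card_union_of_disjoint d1, e1, e2] at this
  rw [two_mul, ← this]
  refine card_le_card ?_
  rintro ⟨a, b⟩ h
  simp only [mem_union, cherriesIn, mem_filter, mem_product, mem_image, Prod.mk.injEq, hm,
    cherryPartners] at h
  simp only [cherriesIn, mem_filter, mem_product, mem_insert]
  rcases h with h | ⟨x, hx, rfl, rfl⟩ | ⟨x, hx, rfl, rfl⟩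
  · exact ⟨⟨Or.inr h.1.1, Or.inr h.1.2⟩, h.2⟩
  · exact ⟨⟨Or.inr hx.1, Or.inl rfl⟩, hx.2⟩
  · exact ⟨⟨Or.inl rfl, Or.inr hx.1⟩, hx.2.1.symm, by rw [cherryClass_comm]; exact hx.2.2⟩

/-- Write `s` for the number of vertices in which an added edge meets the span of the earlier ones.
The excess `#(vertexSpan F) - (r - 2) * #F` is at most `3` and drops by `s - 2` at this addition. If it
ends up positive, then `s ≤ 4` throughout, so each new pair of ordered cherries comes with at most
`3 * (4 * r)` new ordered triangles. -/
lemma Built.card_trianglesIn_le (hr : 2 ≤ r) (hu : Uniform E r) (hl : Linear E)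
    (h : Built E q F) (hF : (r - 2) * #F < #(vertexSpan F)) :
    #(trianglesIn E q F) ≤ 6 * r * #(cherriesIn E q F) := by
  obtain ⟨s, rfl⟩ := Nat.exists_eq_add_of_le' hr
  induction h with
  | @cherry e f h hq =>
    classical
    suffices trianglesIn E q {e, f} = ∅ by simp [this]
    rw [trianglesIn, filter_eq_empty_iff]
    rintro ⟨a, b, d⟩ h1 ⟨h2, -⟩
    simp only [mem_product, mem_insert, mem_singleton] at h1
    have h12 := h2.ne₁₂
    have h13 := h2.ne₁₃
    have h23 := h2.ne₂₃
    dsimp only at h12 h13 h23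
    grind
  | @step F e f g hB he hf hg h _ ih =>
    have h1 := card_span_insert F g
    have h2 := h.two_le_card_inter_span he hf
    have h3 := hB.card_span_le hr hu
    rw [hu g h.mem₃] at h1
    rw [card_insert_of_notMem hg] at hF
    simp only [Nat.add_sub_cancel] at ih hF h3
    have h4 : #(g ∩ vertexSpan F) ≤ 4 := by linarith
    have h5 := ih (by linarith)
    have h6 := card_trianglesIn_insert (q := q) hr hu hl hg
    have h7 := card_cherriesIn_insert (E := E) (q := q) hg
    set m := #(cherryPartners E q F g)
    have h8 : m * ((s + 2) * #(g ∩ vertexSpan F)) ≤ m * ((s + 2) * 4) := by gcongr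
    nlinarith

/-- A largest `F` built from the class `q` contains all edges occurring in the cherries of `q`: the
cherries of `q` within `F` are closed under `TriangleStep`. -/
lemma exists_built_maximal (q : CherryClass E) {e f : Finset V} (h : IsCherry E e f)
    (hq : cherryClass E e f = q) :
    ∃ F, Built E q F ∧ ∀ e' f', cherryClass E e' f' = q → e' ∈ F ∧ f' ∈ F := by
  classical
  obtain ⟨F, hF, hmax⟩ := exists_max_image (E.powerset.filter fun F => Built E q F) card
    ⟨{e, f}, mem_filter.2 ⟨mem_powerset.2 (Built.cherry h hq).subset, .cherry h hq⟩⟩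
  have hB := (mem_filter.1 hF).2
  refine ⟨F, hB, fun e' f' hq' => ?_⟩
  have hclosed : ∀ a b g, a ∈ F → b ∈ F → IsTriangle E a b g → cherryClass E a b = q → g ∈ F := by
    intro a b g ha hb ht hq
    by_contra hg
    have hB' := Built.step hB ha hb hg ht hq
    have := hmax _ (mem_filter.2 ⟨mem_powerset.2 hB'.subset, hB'⟩)
    rw [card_insert_of_notMem hg] at this
    omega
  obtain ⟨a, b, ha, hb, hab⟩ : ∃ a b, a ∈ F ∧ b ∈ F ∧ cherryClass E a b = q := by
    clear hclosed hmax hF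
    induction hB with
    | @cherry e f h hq => exact ⟨e, f, by simp, by simp, hq⟩
    | step _ _ _ _ _ _ ih =>
      obtain ⟨a, b, ha, hb, hab⟩ := ih
      exact ⟨a, b, mem_insert_of_mem ha, mem_insert_of_mem hb, hab⟩
  have := mem_of_cherryClass_eq (S := fun p => p.1 ∈ F ∧ p.2 ∈ F ∧ cherryClass E p.1 p.2 = q)
    ?_ (hab.trans hq'.symm) ⟨ha, hb, hab⟩
  · exact ⟨this.1, this.2.1⟩
  · rintro p p' ⟨h1, h2, h3⟩ (rfl | ⟨g, hg, rfl⟩)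
    · exact ⟨h2, h1, by rw [cherryClass_comm]; exact h3⟩
    · exact ⟨h1, hclosed _ _ _ h1 h2 hg h3, by rw [← hg.cherryClass_eq]; exact h3⟩

/-! ### Counting cherries and edges -/

open Classical in
/-- All triangles of `E`, as ordered triples. -/
noncomputable def triangles (E : Finset (Finset V)) : Finset (Finset V × Finset V × Finset V) :=
  (E ×ˢ E ×ˢ E).filter fun t => IsTriangle E t.1 t.2.1 t.2.2

open Classical in
/-- All cherries of `E`, as ordered pairs. -/
noncomputable def cherries (E : Finset (Finset V)) : Finset (Finset V × Finset V) :=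
  (E ×ˢ E).filter fun p => IsCherry E p.1 p.2

lemma mem_triangles {e f g : Finset V} : (e, f, g) ∈ triangles E ↔ IsTriangle E e f g := by
  simp only [triangles, mem_filter, mem_product, and_iff_right_iff_imp]
  exact fun h => ⟨h.mem₁, h.mem₂, h.mem₃⟩

lemma mem_cherries {e f : Finset V} : (e, f) ∈ cherries E ↔ IsCherry E e f := by
  simp only [cherries, mem_filter, mem_product, and_iff_right_iff_imp]
  exact fun h => ⟨h.1, h.2.1⟩

lemma card_degree_mul_le [Fintype V] (hu : Uniform E r) (hl : Linear E) (x : V) :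
    #(E.filter (x ∈ ·)) * (r - 1) ≤ Fintype.card V := by
  have h : #((E.filter (x ∈ ·)).biUnion fun e => e.erase x) = #(E.filter (x ∈ ·)) * (r - 1) := by
    rw [card_biUnion]
    · refine sum_const_nat fun e he => ?_
      rw [mem_filter] at he
      rw [card_erase_of_mem he.2, hu e he.1]
    · intro e he f hf hef
      rw [mem_coe, mem_filter] at he hf
      rw [Function.onFun, disjoint_left]
      intro y hy hy'
      rw [mem_erase] at hy hy'
      exact hef (hl e he.1 f hf.1 x he.2 y hy.2 hf.2 hy'.2 hy.1.symm)
  rw [← h]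
  exact card_le_univ _

lemma card_cherries_mul_le [Fintype V] (hu : Uniform E r) (hl : Linear E) :
    #(cherries E) * (r - 1) ^ 2 ≤ Fintype.card V ^ 3 := by
  have h : cherries E ⊆
      univ.biUnion fun x => E.filter (x ∈ ·) ×ˢ E.filter (x ∈ ·) := by
    rintro ⟨e, f⟩ hef
    obtain ⟨he, hf, -, x, hx⟩ := mem_cherries.1 hef
    rw [mem_inter] at hx
    simp only [mem_biUnion, mem_product, mem_filter, mem_univ, true_and]
    exact ⟨x, ⟨he, hx.1⟩, hf, hx.2⟩
  calc #(cherries E) * (r - 1) ^ 2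
      ≤ (∑ x : V, #(E.filter (x ∈ ·) ×ˢ E.filter (x ∈ ·))) * (r - 1) ^ 2 := by
        gcongr
        exact (card_le_card h).trans card_biUnion_le
    _ = ∑ x : V, (#(E.filter (x ∈ ·)) * (r - 1)) ^ 2 := by
        rw [sum_mul]
        refine sum_congr rfl fun x _ => ?_
        rw [card_product]
        ring
    _ ≤ ∑ _x : V, Fintype.card V ^ 2 := by
        gcongr with x
        exact card_degree_mul_le hu hl x
    _ = Fintype.card V ^ 3 := by
        rw [sum_const, card_univ, smul_eq_mul]
        ring

lemma card_edges_le [Fintype V] (hr : 2 ≤ r) (hu : Uniform E r) (hl : Linear E) :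
    #E ≤ Fintype.card V ^ 2 := by
  have h : E ⊆ univ.biUnion fun x => E.filter (x ∈ ·) := by
    intro e he
    obtain ⟨x, hx⟩ := card_pos.1 (by rw [hu e he]; omega)
    simp only [mem_biUnion, mem_filter, mem_univ, true_and]
    exact ⟨x, he, hx⟩
  calc #E ≤ ∑ x : V, #(E.filter (x ∈ ·)) := (card_le_card h).trans card_biUnion_le
    _ ≤ ∑ _x : V, Fintype.card V := by
        gcongr with x
        exact (Nat.le_mul_of_pos_right _ (by omega)).trans (card_degree_mul_le hu hl x)
    _ = Fintype.card V ^ 2 := by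
        rw [sum_const, card_univ, smul_eq_mul]
        ring

/-! ### Concatenating sparse edge sets -/

/-- If `F₀` spans at most `(r - 2) * #F₀` vertices, then edges from a disjoint `F` can be added to it
at the same excess of at most `3` that they have on their own. -/
lemma HasSparsePrefixes.union {F₀ F : Finset (Finset V)} (h₀ : HasSparsePrefixes r F₀)
    (hF₀ : #(vertexSpan F₀) ≤ (r - 2) * #F₀) (h : HasSparsePrefixes r F) (hd : Disjoint F₀ F) :
    HasSparsePrefixes r (F₀ ∪ F) := by
  intro j hj
  rw [card_union_of_disjoint hd] at hj
  rcases le_total j #F₀ with hj' | hj'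
  · obtain ⟨F', h1, h2⟩ := h₀ j hj'
    exact ⟨F', h1.trans subset_union_left, h2⟩
  · obtain ⟨i, rfl⟩ := Nat.exists_eq_add_of_le hj'
    obtain ⟨F', h1, h2, h3⟩ := h i (by omega)
    refine ⟨F₀ ∪ F', union_subset_union_right h1, ?_, ?_⟩
    · rw [card_union_of_disjoint (hd.mono_right h1), h2]
    · have : vertexSpan (F₀ ∪ F') = vertexSpan F₀ ∪ vertexSpan F' := by
        ext x; simp only [vertexSpan, mem_biUnion, mem_union]; grind
      rw [this]
      have := card_union_le (vertexSpan F₀) (vertexSpan F')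
      rw [mul_add]
      omega

lemma card_span_union_le {F₀ F : Finset (Finset V)} (h₀ : #(vertexSpan F₀) ≤ (r - 2) * #F₀)
    (h : #(vertexSpan F) ≤ (r - 2) * #F) (hd : Disjoint F₀ F) :
    #(vertexSpan (F₀ ∪ F)) ≤ (r - 2) * #(F₀ ∪ F) := by
  have : vertexSpan (F₀ ∪ F) = vertexSpan F₀ ∪ vertexSpan F := by
    ext x; simp only [vertexSpan, mem_biUnion, mem_union]; grind
  rw [this, card_union_of_disjoint hd, mul_add]
  exact (card_union_le _ _).trans (add_le_add h₀ h)

/-- Without `k` edges on `(r - 2) * k + 3` vertices, the edge set of each class has fewer than `k`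
edges. The classes of positive excess have few triangles per cherry. The other ones all meet one
set `F₀` of fewer than `k` edges, since their edge sets could otherwise be concatenated, so they
contain `O(n ^ 2)` triangles in total. -/
lemma card_triangles_le [Fintype V] {k : ℕ} (hr : 2 ≤ r) (hu : Uniform E r) (hl : Linear E)
    (hno : ∀ F ⊆ E, #F = k → (r - 2) * k + 3 < #(vertexSpan F)) :
    #(triangles E) ≤ 6 * r * #(cherries E) + k ^ 4 * Fintype.card V ^ 2 := by
  classical
  have hlt : ∀ F ⊆ E, HasSparsePrefixes r F → #F < k := by
    intro F hF hs
    by_contra! hk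
    obtain ⟨F', h1, h2, h3⟩ := hs k hk
    exact (hno F' (h1.trans hF) h2).not_ge h3
  obtain ⟨F₀, hF₀, hmax⟩ := exists_max_image
    (E.powerset.filter fun F => HasSparsePrefixes r F ∧ #(vertexSpan F) ≤ (r - 2) * #F) card
    ⟨∅, by
      simp only [mem_filter, empty_mem_powerset, true_and]
      refine ⟨fun j hj => ⟨∅, Subset.rfl, ?_, by simp⟩, by simp⟩
      simpa [eq_comm] using hj⟩
  simp only [mem_filter, mem_powerset] at hF₀ hmax
  obtain ⟨hF₀E, hF₀s, hF₀c⟩ := hF₀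
  -- `Q` holds the classes of all cherries, `B` those of cherries starting with an edge of `F₀`.
  set Q := (cherries E).image fun p => cherryClass E p.1 p.2 with hQ
  set B := (F₀ ×ˢ E).image fun p => cherryClass E p.1 p.2 with hB
  have hBcard : #B ≤ k * Fintype.card V ^ 2 := by
    refine card_image_le.trans ?_
    rw [card_product]
    exact Nat.mul_le_mul (hlt F₀ hF₀E hF₀s).le (card_edges_le hr hu hl)
  have hT : ∀ t ∈ triangles E, cherryClass E t.1 t.2.1 ∈ Q := by
    rintro ⟨e, f, g⟩ ht
    exact mem_image.2 ⟨(e, f), mem_cherries.2 (mem_triangles.1 ht).isCherry₁₂, rfl⟩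
  have hM : ∀ p ∈ cherries E, cherryClass E p.1 p.2 ∈ Q := fun p hp => mem_image_of_mem _ hp
  have hclass : ∀ q ∈ Q, #((triangles E).filter fun t => cherryClass E t.1 t.2.1 = q) ≤
      6 * r * #((cherries E).filter fun p => cherryClass E p.1 p.2 = q) +
        if q ∈ B then k ^ 3 else 0 := by
    intro q hq
    obtain ⟨⟨e, f⟩, hef, hq⟩ := mem_image.1 hq
    obtain ⟨F, hF, hcov⟩ := exists_built_maximal q (mem_cherries.1 hef) hq
    have hFE := hF.subset
    have hFs := hF.hasSparsePrefixes hr hu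
    have h1 : #((triangles E).filter fun t => cherryClass E t.1 t.2.1 = q) ≤
        #(trianglesIn E q F) := by
      refine card_le_card ?_
      rintro ⟨a, b, d⟩ ht
      rw [mem_filter, mem_triangles] at ht
      simp only [trianglesIn, mem_filter, mem_product]
      exact ⟨⟨(hcov _ _ ht.2).1, (hcov _ _ ht.2).2,
        (hcov _ _ (ht.1.cherryClass_eq.symm.trans ht.2)).2⟩, ht⟩
    refine h1.trans ?_
    rcases lt_or_ge ((r - 2) * #F) #(vertexSpan F) with hc | hc
    · refine (hF.card_trianglesIn_le hr hu hl hc).trans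
        ((Nat.mul_le_mul_left _ (card_le_card ?_)).trans (Nat.le_add_right _ _))
      rintro ⟨a, b⟩ hab
      simp only [cherriesIn, mem_filter] at hab
      exact mem_filter.2 ⟨mem_cherries.2 hab.2.1, hab.2.2⟩
    -- A class of nonpositive excess meets `F₀`, by maximality of `F₀`.
    · have hnd : ¬ Disjoint F₀ F := by
        intro hd
        have h2 := hmax (F₀ ∪ F) ⟨union_subset hF₀E hFE, hF₀s.union hF₀c hFs hd,
          card_span_union_le hF₀c hc hd⟩
        rw [card_union_of_disjoint hd] at h2
        have h3 : #F = 0 := by omega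
        rw [card_eq_zero] at h3
        have := (hcov e f hq).1
        simp [h3] at this
      obtain ⟨a, ha, ha'⟩ := not_disjoint_iff.1 hnd
      obtain ⟨b, hab, hq'⟩ := hF.exists_cherry a ha'
      have hqB : q ∈ B := mem_image.2 ⟨(a, b), mem_product.2 ⟨ha, hab.2.1⟩, hq'⟩
      rw [if_pos hqB]
      refine le_add_left ?_
      calc #(trianglesIn E q F) ≤ #(F ×ˢ F ×ˢ F) := card_filter_le _ _
        _ = #F ^ 3 := by rw [card_product, card_product]; ring
        _ ≤ k ^ 3 := Nat.pow_le_pow_left (hlt F hFE hFs).le 3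
  calc #(triangles E)
      = ∑ q ∈ Q, #((triangles E).filter fun t => cherryClass E t.1 t.2.1 = q) :=
        card_eq_sum_card_fiberwise hT
    _ ≤ ∑ q ∈ Q, (6 * r * #((cherries E).filter fun p => cherryClass E p.1 p.2 = q) +
        if q ∈ B then k ^ 3 else 0) := sum_le_sum hclass
    _ = 6 * r * #(cherries E) + #(Q.filter (· ∈ B)) * k ^ 3 := by
        rw [sum_add_distrib, ← mul_sum, ← card_eq_sum_card_fiberwise hM, ← sum_filter, sum_const,
          smul_eq_mul]
    _ ≤ 6 * r * #(cherries E) + (k * Fintype.card V ^ 2) * k ^ 3 := by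
        gcongr
        exact (card_le_card fun q hq => (mem_filter.1 hq).2).trans hBcard
    _ = _ := by ring

/-- A linear `r`-graph on `n` vertices has at most `n ^ 3 / (r - 1) ^ 2` cherries, so a positive
proportion `1 / N` of triangles contradicts `card_triangles_le` once `r` is large in terms of `N`,
independently of `k`. -/
theorem exists_sparse_of_many_triangles [Fintype V] {N k : ℕ} (hr : 2 ≤ r) (hN : 24 * N ≤ r - 1)
    (hu : Uniform E r) (hl : Linear E) (hn : 2 * N * k ^ 4 < Fintype.card V)
    (hT : Fintype.card V ^ 3 ≤ N * #(triangles E)) :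
    ∃ F ⊆ E, #F = k ∧ #(vertexSpan F) ≤ (r - 2) * k + 3 := by
  by_contra! hno
  have h1 := card_triangles_le hr hu hl hno
  have h2 := card_cherries_mul_le hu hl
  obtain ⟨s, rfl⟩ := Nat.exists_eq_add_of_le' hr
  simp only [show s + 2 - 1 = s + 1 by omega] at h2 hN
  set n := Fintype.card V
  set M := #(cherries E)
  set T := #(triangles E)
  have h3 : (s + 1) * n ^ 3 ≤ 12 * N * n ^ 3 + N * k ^ 4 * n ^ 2 * (s + 1) := by
    calc (s + 1) * n ^ 3 ≤ (s + 1) * (N * T) := by gcongr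
      _ ≤ (s + 1) * (N * (6 * (s + 2) * M + k ^ 4 * n ^ 2)) := by gcongr
      _ ≤ (s + 1) * (N * (6 * (2 * (s + 1)) * M + k ^ 4 * n ^ 2)) := by gcongr; omega
      _ = 12 * N * (M * (s + 1) ^ 2) + N * k ^ 4 * n ^ 2 * (s + 1) := by ring
      _ ≤ _ := by gcongr
  have h4 : 24 * N * n ^ 3 ≤ (s + 1) * n ^ 3 := by gcongr
  have h5 : (s + 1) * n ^ 3 ≤ (s + 1) * (2 * N * k ^ 4 * n ^ 2) := by linarith
  have h6 := Nat.le_of_mul_le_mul_left h5 (by omega)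
  have h7 : 0 < n := by omega
  have h8 : 2 * N * k ^ 4 * n ^ 2 < n * n ^ 2 := by gcongr
  have : n ^ 3 = n * n ^ 2 := by ring
  omega

/-! ### Ramsey's theorem for triangles and sampling -/

/-- The number of points that forces a monochromatic triangle in a colouring of the pairs of points
with `l` colours. The value at `0` is `3` rather than `2`, so that any two indices below the bound
leave room for a third. -/
def ramseyBound : ℕ → ℕ
  | 0 => 3
  | l + 1 => (l + 1) * ramseyBound l + 2

lemma three_le_ramseyBound (l : ℕ) : 3 ≤ ramseyBound l := by
  induction l with
  | zero => exact le_rfl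
  | succ l ih =>
    rw [ramseyBound]
    nlinarith

variable {C : Type*}

/-- Ramsey's theorem for triangles. The colouring need not be symmetric: only the colours of `(x, y)`,
`(x, z)` and `(y, z)` are compared. -/
lemma exists_monochromatic_triangle [DecidableEq C] (κ : V → V → C) (L : Finset C) (S : Finset V)
    (hκ : ∀ x ∈ S, ∀ y ∈ S, x ≠ y → κ x y ∈ L) (hS : ramseyBound #L ≤ #S) :
    ∃ x ∈ S, ∃ y ∈ S, ∃ z ∈ S, x ≠ y ∧ x ≠ z ∧ y ≠ z ∧ κ x y = κ x z ∧ κ x z = κ y z := by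
  induction hl : #L generalizing L S with
  | zero =>
    rw [hl] at hS
    obtain ⟨x, hx, y, hy, hxy⟩ := one_lt_card.1 (lt_of_lt_of_le (by decide : 1 < 3) hS)
    rw [card_eq_zero] at hl
    simpa [hl] using hκ x hx y hy hxy
  | succ l ih =>
    rw [hl, ramseyBound] at hS
    obtain ⟨x, hx⟩ := card_pos.1 (by omega : 0 < #S)
    have hmaps : ∀ y ∈ S.erase x, κ x y ∈ L := fun y hy =>
      hκ x hx y (mem_of_mem_erase hy) (ne_of_mem_erase hy).symm
    obtain ⟨i, hi, hlt⟩ := exists_lt_card_fiber_of_mul_lt_card_of_maps_to (n := ramseyBound l) hmaps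
      (by rw [card_erase_of_mem hx, hl]; omega)
    set S' := (S.erase x).filter fun y => κ x y = i with hS'
    have hmem : ∀ y ∈ S', y ∈ S ∧ x ≠ y ∧ κ x y = i := by
      intro y hy
      rw [hS', mem_filter, mem_erase] at hy
      exact ⟨hy.1.2, hy.1.1.symm, hy.2⟩
    by_cases h : ∃ y ∈ S', ∃ z ∈ S', y ≠ z ∧ κ y z = i
    · obtain ⟨y, hy, z, hz, hyz, hi⟩ := h
      obtain ⟨hy1, hy2, hy3⟩ := hmem y hy
      obtain ⟨hz1, hz2, hz3⟩ := hmem z hz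
      exact ⟨x, hx, y, hy1, z, hz1, hy2, hz2, hyz, hy3.trans hz3.symm, hz3.trans hi.symm⟩
    · push Not at h
      have hcard : #(L.erase i) = l := by rw [card_erase_of_mem hi, hl]; rfl
      obtain ⟨a, ha, b, hb, d, hd, habd⟩ := ih (L.erase i) S'
        (fun y hy z hz hyz => mem_erase.2 ⟨h y hy z hz hyz,
          hκ y (hmem y hy).1 z (hmem z hz).1 hyz⟩) (by rw [hcard]; exact hlt.le) hcard
      exact ⟨a, (hmem a ha).1, b, (hmem b hb).1, d, (hmem d hd).1, habd⟩

lemma card_filter_triple_mem_mul_le [Fintype V] {R : ℕ} {i j k : Fin R} (hij : i ≠ j) (hik : i ≠ k)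
    (hjk : j ≠ k) (X : Finset (V × V × V)) :
    #(univ.filter fun f : Fin R → V => (f i, f j, f k) ∈ X) * Fintype.card V ^ 3 ≤
      #X * Fintype.card V ^ R := by
  classical
  have hR : Fintype.card {a : Fin R // a ∈ ({i, j, k} : Finset (Fin R))ᶜ} + 3 = R := by
    have h1 := card_compl_add_card ({i, j, k} : Finset (Fin R))
    rw [Fintype.card_fin, card_eq_three.2 ⟨i, j, k, hij, hik, hjk, rfl⟩] at h1
    rwa [Fintype.card_coe]
  have h : #(univ.filter fun f : Fin R → V => (f i, f j, f k) ∈ X) ≤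
      #(X ×ˢ (univ : Finset ({a : Fin R // a ∈ ({i, j, k} : Finset (Fin R))ᶜ} → V))) := by
    refine card_le_card_of_injOn (fun f => ((f i, f j, f k), fun a => f a.1)) ?_ ?_
    · intro f hf
      simpa using hf
    · intro f _ g _ hfg
      simp only [Prod.mk.injEq] at hfg
      obtain ⟨⟨h1, h2, h3⟩, h4⟩ := hfg
      funext a
      by_cases ha : a ∈ ({i, j, k} : Finset (Fin R))
      · simp only [mem_insert, mem_singleton] at ha
        rcases ha with rfl | rfl | rfl <;> assumption
      · exact congrFun h4 ⟨a, mem_compl.2 ha⟩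
  rw [card_product, card_univ, Fintype.card_fun] at h
  calc _ ≤ _ := Nat.mul_le_mul_right _ h
    _ = _ := by rw [mul_assoc, ← pow_add, hR]

/-- Supersaturation by sampling: if every `R`-tuple of points contains a triple from `X`, then `X` is
a positive proportion of all triples. -/
lemma card_pow_three_le_of_forall_exists_mem [Fintype V] {R : ℕ} (X : Finset (V × V × V))
    (h : ∀ f : Fin R → V, ∃ i j k, i ≠ j ∧ i ≠ k ∧ j ≠ k ∧ (f i, f j, f k) ∈ X) :
    Fintype.card V ^ 3 ≤ R ^ 3 * #X := by
  classical
  rcases Nat.eq_zero_or_pos (Fintype.card V) with h0 | h0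
  · simp [h0]
  set I := (univ : Finset (Fin R × Fin R × Fin R)).filter fun t =>
    t.1 ≠ t.2.1 ∧ t.1 ≠ t.2.2 ∧ t.2.1 ≠ t.2.2 with hI
  have hcover : (univ : Finset (Fin R → V)) ⊆
      I.biUnion fun t => univ.filter fun f => (f t.1, f t.2.1, f t.2.2) ∈ X := by
    intro f _
    obtain ⟨i, j, k, hij, hik, hjk, hX⟩ := h f
    simp only [mem_biUnion, hI, mem_filter, mem_univ, true_and]
    exact ⟨(i, j, k), ⟨hij, hik, hjk⟩, hX⟩
  have h1 := (card_le_card hcover).trans card_biUnion_le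
  rw [card_univ, Fintype.card_fun, Fintype.card_fin] at h1
  have hIcard : #I ≤ R ^ 3 := by
    refine (card_filter_le _ _).trans_eq ?_
    rw [card_univ, Fintype.card_prod, Fintype.card_prod, Fintype.card_fin]
    ring
  refine Nat.le_of_mul_le_mul_left ?_ (pow_pos h0 R)
  calc Fintype.card V ^ R * Fintype.card V ^ 3
      ≤ (∑ t ∈ I, #(univ.filter fun f : Fin R → V => (f t.1, f t.2.1, f t.2.2) ∈ X)) *
          Fintype.card V ^ 3 := Nat.mul_le_mul_right _ h1
    _ ≤ ∑ _t ∈ I, #X * Fintype.card V ^ R := by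
        rw [sum_mul]
        refine sum_le_sum fun t ht => ?_
        obtain ⟨-, h1, h2, h3⟩ := mem_filter.1 ht
        exact card_filter_triple_mem_mul_le h1 h2 h3 X
    _ = #I * (#X * Fintype.card V ^ R) := by rw [sum_const, smul_eq_mul]
    _ ≤ R ^ 3 * (#X * Fintype.card V ^ R) := Nat.mul_le_mul_right _ hIcard
    _ = _ := by ring

/-! ### Monochromatic triangles in Steiner systems -/

/-- The points lie on a common edge. Triples with `x = y` are counted as collinear as well, so that
the points of a noncollinear triple are distinct whenever any two points lie on an edge. -/
def IsCollinear (E : Finset (Finset V)) (x y z : V) : Prop :=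
  x = y ∨ ∃ e ∈ E, x ∈ e ∧ y ∈ e ∧ z ∈ e

open Classical in
lemma card_collinear_le [Fintype V] (hu : Uniform E r) (hl : Linear E) :
    #(univ.filter fun t : V × V × V => IsCollinear E t.1 t.2.1 t.2.2) ≤
      (r + 1) * Fintype.card V ^ 2 := by
  set X := univ.filter fun t : V × V × V => t.1 ≠ t.2.1 ∧ ∃ e ∈ E, t.1 ∈ e ∧ t.2.1 ∈ e ∧ t.2.2 ∈ e
    with hX
  have hsub : (univ.filter fun t : V × V × V => IsCollinear E t.1 t.2.1 t.2.2) ⊆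
      (univ : Finset (V × V)).image (fun p => (p.1, p.1, p.2)) ∪ X := by
    rintro ⟨x, y, z⟩ ht
    have hcol : IsCollinear E x y z := (mem_filter.1 ht).2
    by_cases hxy : x = y
    · exact mem_union_left _ (mem_image.2 ⟨(x, z), mem_univ _, by rw [hxy]⟩)
    · exact mem_union_right _ (mem_filter.2 ⟨mem_univ _, hxy, Or.resolve_left hcol hxy⟩)
  have hcard : #(univ : Finset (V × V)) = Fintype.card V ^ 2 := by
    rw [card_univ, Fintype.card_prod, sq]
  have hXcard : #X ≤ r * #(univ : Finset (V × V)) := by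
    refine card_le_mul_card_image_of_maps_to (f := fun t => (t.1, t.2.1)) (fun _ _ => mem_univ _)
      r ?_
    rintro ⟨x, y⟩ -
    rcases (X.filter fun t => (t.1, t.2.1) = (x, y)).eq_empty_or_nonempty with h | ⟨t, ht⟩
    · rw [h, card_empty]
      exact Nat.zero_le _
    simp only [hX, mem_filter, mem_univ, true_and, Prod.mk.injEq] at ht
    obtain ⟨⟨hxy, e, he, hxe, hye, -⟩, rfl, rfl⟩ := ht
    rw [← hu e he]
    refine card_le_card_of_injOn (fun t => t.2.2) ?_ ?_
    · rintro ⟨x', y', z⟩ hs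
      simp only [hX, coe_filter, mem_filter, mem_univ, true_and, Prod.mk.injEq] at hs
      obtain ⟨⟨-, f, hf, hxf, hyf, hzf⟩, rfl, rfl⟩ := hs
      rwa [hl e he f hf _ hxe _ hye hxf hyf hxy]
    · rintro ⟨x', y', z⟩ hs ⟨x'', y'', z'⟩ hs' hz
      simp only [coe_filter, Prod.mk.injEq] at hs hs'
      obtain ⟨-, rfl, rfl⟩ := hs
      obtain ⟨-, rfl, rfl⟩ := hs'
      exact Prod.ext rfl (Prod.ext rfl hz)
  have h1 := (card_le_card hsub).trans (card_union_le _ _)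
  have h2 : #((univ : Finset (V × V)).image fun p => (p.1, p.1, p.2)) ≤ _ := card_image_le
  rw [hcard] at hXcard h2
  linarith

/-- Some colour class of a Steiner system on `n` points coloured with `c` colours, `n` large, has at
least `n ^ 3 / triangleFactor c` triangles. -/
def triangleFactor (c : ℕ) : ℕ := 2 * ramseyBound c ^ 3 * c

lemma exists_colour_many_triangles [Fintype V] [Fintype C] [Nonempty C] [DecidableEq C]
    (hu : Uniform E r) (hl : Linear E)
    (hE : ∀ x y, x ≠ y → ∃ e ∈ E, x ∈ e ∧ y ∈ e) (χ : Finset V → C)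
    (hn : 2 * ramseyBound (Fintype.card C) ^ 3 * (r + 1) ≤ Fintype.card V) :
    ∃ i, Fintype.card V ^ 3 ≤
      triangleFactor (Fintype.card C) * #(triangles (E.filter (χ · = i))) := by
  classical
  have hline : ∀ x y, ∃ e, x ≠ y → e ∈ E ∧ x ∈ e ∧ y ∈ e := by
    intro x y
    by_cases hxy : x = y
    · exact ⟨∅, fun h => (h hxy).elim⟩
    · obtain ⟨e, he⟩ := hE x y hxy
      exact ⟨e, fun _ => he⟩
  choose line hline using hline
  set R := ramseyBound (Fintype.card C) with hR
  -- `X` holds the collinear triples of points, which are few; `Y` holds the noncollinear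
  -- monochromatic ones, which span triangles of a single colour.
  set X := univ.filter fun t : V × V × V => IsCollinear E t.1 t.2.1 t.2.2 with hX
  set Y := univ.filter fun t : V × V × V => ¬ IsCollinear E t.1 t.2.1 t.2.2 ∧
    χ (line t.1 t.2.1) = χ (line t.1 t.2.2) ∧ χ (line t.1 t.2.2) = χ (line t.2.1 t.2.2) with hY
  have hXY : Fintype.card V ^ 3 ≤ R ^ 3 * #(X ∪ Y) := by
    refine card_pow_three_le_of_forall_exists_mem _ fun f => ?_
    by_cases hf : Function.Injective f
    · obtain ⟨x, hx, y, hy, z, hz, hxy, hxz, hyz, h⟩ := exists_monochromatic_triangle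
        (fun x y => χ (line x y)) univ (univ.image f) (fun _ _ _ _ _ => mem_univ _)
        (by rw [card_image_of_injective _ hf, card_univ, card_univ, Fintype.card_fin])
      obtain ⟨i, -, rfl⟩ := mem_image.1 hx
      obtain ⟨j, -, rfl⟩ := mem_image.1 hy
      obtain ⟨k, -, rfl⟩ := mem_image.1 hz
      refine ⟨i, j, k, ne_of_apply_ne f hxy, ne_of_apply_ne f hxz, ne_of_apply_ne f hyz, ?_⟩
      by_cases hcol : IsCollinear E (f i) (f j) (f k)
      · exact mem_union_left _ (mem_filter.2 ⟨mem_univ _, hcol⟩)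
      · exact mem_union_right _ (mem_filter.2 ⟨mem_univ _, hcol, h⟩)
    · simp only [Function.Injective, not_forall] at hf
      obtain ⟨i, j, hij, hne⟩ := hf
      have h3 := three_le_ramseyBound (Fintype.card C)
      obtain ⟨k, hk⟩ : ∃ k, k ∉ ({i, j} : Finset (Fin R)) := by
        by_contra! hall
        have h4 := card_le_card (fun k _ => hall k : (univ : Finset (Fin R)) ⊆ {i, j})
        rw [card_univ, Fintype.card_fin] at h4
        have := card_le_two (a := i) (b := j)
        omega
      simp only [mem_insert, mem_singleton, not_or] at hk
      exact ⟨i, j, k, hne, fun h => hk.1 h.symm, fun h => hk.2 h.symm,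
        mem_union_left _ (mem_filter.2 ⟨mem_univ _, Or.inl hij⟩)⟩
  have hsub : ∀ i, ∀ e ∈ E.filter (χ · = i), e ∈ E := fun i e he => (mem_filter.1 he).1
  have hYcard : #Y ≤ ∑ i, #(triangles (E.filter (χ · = i))) := by
    refine le_trans ?_ card_biUnion_le
    have hdata : ∀ t ∈ Y, (line t.1 t.2.1 ∈ E ∧ t.1 ∈ line t.1 t.2.1 ∧ t.2.1 ∈ line t.1 t.2.1) ∧
        (line t.1 t.2.2 ∈ E ∧ t.1 ∈ line t.1 t.2.2 ∧ t.2.2 ∈ line t.1 t.2.2) ∧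
        (line t.2.1 t.2.2 ∈ E ∧ t.2.1 ∈ line t.2.1 t.2.2 ∧ t.2.2 ∈ line t.2.1 t.2.2) ∧
        t.1 ∉ line t.2.1 t.2.2 ∧ t.2.1 ∉ line t.1 t.2.2 ∧ t.2.2 ∉ line t.1 t.2.1 := by
      rintro ⟨x, y, z⟩ ht
      simp only [hY, mem_filter, mem_univ, true_and, IsCollinear, not_or, not_exists,
        not_and] at ht
      obtain ⟨⟨hxy, hcol⟩, -⟩ := ht
      have h1 := hline x y hxy
      have hxz : x ≠ z := by
        rintro rfl
        exact hcol _ h1.1 h1.2.1 h1.2.2 h1.2.1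
      have hyz : y ≠ z := by
        rintro rfl
        exact hcol _ h1.1 h1.2.1 h1.2.2 h1.2.2
      have h2 := hline x z hxz
      have h3 := hline y z hyz
      exact ⟨h1, h2, h3, fun h => hcol _ h3.1 h h3.2.1 h3.2.2,
        fun h => hcol _ h2.1 h2.2.1 h h2.2.2, fun h => hcol _ h1.1 h1.2.1 h1.2.2 h⟩
    have huniq : ∀ e ∈ E, ∀ f ∈ E, ∀ x y z : V, x ∈ e → x ∈ f → y ∈ e → y ∈ f → z ∈ e → z ∉ f →
        x = y := by
      intro e he f hf x y z hxe hxf hye hyf hze hzf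
      by_contra hxy
      exact hzf (hl e he f hf x hxe y hye hxf hyf hxy ▸ hze)
    refine card_le_card_of_injOn (fun t => (line t.1 t.2.1, line t.1 t.2.2, line t.2.1 t.2.2)) ?_ ?_
    · intro t ht
      obtain ⟨⟨h1, h1x, h1y⟩, ⟨h2, h2x, h2z⟩, ⟨h3, h3y, h3z⟩, hx, hy, hz⟩ := hdata t ht
      rw [mem_coe, hY, mem_filter] at ht
      simp only [mem_coe, mem_biUnion, mem_univ, true_and, mem_triangles]
      refine ⟨χ (line t.1 t.2.1), mem_filter.2 ⟨h1, rfl⟩, mem_filter.2 ⟨h2, ht.2.2.1.symm⟩,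
        mem_filter.2 ⟨h3, (ht.2.2.1.trans ht.2.2.2).symm⟩, ⟨t.1, mem_inter.2 ⟨h1x, h2x⟩⟩,
        ⟨t.2.1, mem_inter.2 ⟨h1y, h3y⟩⟩, ⟨t.2.2, mem_inter.2 ⟨h2z, h3z⟩⟩, ?_⟩
      rw [eq_empty_iff_forall_notMem]
      intro w hw
      simp only [mem_inter] at hw
      rw [huniq _ h1 _ h2 w t.1 t.2.1 hw.1.1 hw.1.2 h1x h2x h1y hy] at hw
      exact hx hw.2
    · intro t ht s hs hts
      obtain ⟨⟨h1, h1x, h1y⟩, ⟨h2, h2x, h2z⟩, ⟨h3, h3y, h3z⟩, hx, hy, hz⟩ := hdata t ht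
      obtain ⟨⟨-, g1x, g1y⟩, ⟨-, g2x, g2z⟩, ⟨-, g3y, g3z⟩, -⟩ := hdata s hs
      simp only [Prod.mk.injEq] at hts
      rw [← hts.1] at g1x g1y
      rw [← hts.2.1] at g2x g2z
      rw [← hts.2.2] at g3y g3z
      exact Prod.ext (huniq _ h1 _ h2 _ _ _ h1x h2x g1x g2x h1y hy)
        (Prod.ext (huniq _ h1 _ h3 _ _ _ h1y h3y g1y g3y h1x hx)
          (huniq _ h2 _ h3 _ _ _ h2z h3z g2z g3z h2x hx))
  have hXcard : #X ≤ (r + 1) * Fintype.card V ^ 2 := card_collinear_le hu hl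
  set n := Fintype.card V
  have hmain : n ^ 3 ≤ 2 * R ^ 3 * ∑ i, #(triangles (E.filter (χ · = i))) := by
    have h1 : #(X ∪ Y) ≤ #X + #Y := card_union_le _ _
    have h2 : R ^ 3 * #(X ∪ Y) ≤ R ^ 3 * ((r + 1) * n ^ 2 +
        ∑ i, #(triangles (E.filter (χ · = i)))) := by gcongr; omega
    have h3 : 2 * R ^ 3 * (r + 1) * n ^ 2 ≤ n * n ^ 2 := by gcongr
    have h4 : n * n ^ 2 = n ^ 3 := by ring
    linarith
  obtain ⟨i, -, hi⟩ := exists_le_of_sum_le (s := (univ : Finset C)) (f := fun _ => n ^ 3)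
    (g := fun i => triangleFactor (Fintype.card C) * #(triangles (E.filter (χ · = i))))
    univ_nonempty (by
      rw [sum_const, ← mul_sum, smul_eq_mul, card_univ, triangleFactor, mul_right_comm, mul_comm]
      exact Nat.mul_le_mul_right _ hmain)
  exact ⟨i, hi⟩

theorem exists_monochromatic_sparse [Fintype V] [Fintype C] [Nonempty C] [DecidableEq C] {k : ℕ}
    (hr : 24 * triangleFactor (Fintype.card C) + 2 ≤ r) (hu : Uniform E r) (hl : Linear E)
    (hE : ∀ x y, x ≠ y → ∃ e ∈ E, x ∈ e ∧ y ∈ e) (χ : Finset V → C)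
    (hn : 2 * ramseyBound (Fintype.card C) ^ 3 * (r + 1) +
      2 * triangleFactor (Fintype.card C) * k ^ 4 < Fintype.card V) :
    ∃ F ⊆ E, #F = k ∧ #(vertexSpan F) ≤ (r - 2) * k + 3 ∧ ∃ i, ∀ e ∈ F, χ e = i := by
  obtain ⟨i, hi⟩ := exists_colour_many_triangles hu hl hE χ (by omega)
  obtain ⟨F, hF, h1, h2⟩ := exists_sparse_of_many_triangles (E := E.filter (χ · = i)) (k := k)
    (by omega) (by omega) (fun e he => hu e (mem_filter.1 he).1)
    (fun e he f hf => hl e (mem_filter.1 he).1 f (mem_filter.1 hf).1) (by omega) hi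
  exact ⟨F, hF.trans (filter_subset _ _), h1, h2, i, fun e he => (mem_filter.1 (hF he)).2⟩

end BrownErdosSos

open BrownErdosSos in
theorem theorem1 (c : ℕ) :
    ∃ r₀ : ℕ, ∀ r : ℕ, r₀ ≤ r → ∀ k : ℕ, 3 ≤ k →
      ∃ n₀ : ℕ, ∀ (α : Type*) (H : Hypergraph α), V(H).Finite → n₀ < V(H).ncard →
        H.IsCompleteLinear r →
          ∀ χ : E(H) → Fin c,
            ∃ F : Set (Set α),
              H.IsConfiguration ((r - 2) * k + 3) k F ∧ H.IsMonochromatic χ F := by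
  classical
  refine ⟨24 * triangleFactor c + 2, fun r hr k _ =>
    ⟨2 * ramseyBound c ^ 3 * (r + 1) + 2 * triangleFactor c * k ^ 4 + 1,
      fun α H hfin hn hH χ => ?_⟩⟩
  obtain ⟨hu, hl, hex⟩ := hH
  have : Fintype V(H) := hfin.fintype
  have hcard : Fintype.card V(H) = V(H).ncard := by
    rw [← Nat.card_coe_set_eq, Nat.card_eq_fintype_card]
  -- An edge exists, so there is a colour to use as the value of `χ'` off the edge set.
  have hc : Nonempty (Fin c) := by
    obtain ⟨u, v, hu, hv, huv⟩ := (Set.one_lt_ncard_iff hfin).1 (by omega : 1 < V(H).ncard)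
    obtain ⟨e, he, -⟩ := hex u hu v hv huv
    exact ⟨χ ⟨e, he.1⟩⟩
  -- The statement is transferred to finite sets of elements of the subtype `V(H)`.
  let φ : Finset V(H) → Set α := fun s => Subtype.val '' (s : Set V(H))
  have hφ : Function.Injective φ :=
    (Subtype.val_injective.image_injective).comp Finset.coe_injective
  have hmem : ∀ (s : Finset V(H)) (x : V(H)), (x : α) ∈ φ s ↔ x ∈ s := fun s x => by
    simp [φ]
  let E : Finset (Finset V(H)) := Finset.univ.filter fun s => φ s ∈ E(H)
  have hE : ∀ s, s ∈ E ↔ φ s ∈ E(H) := fun s => by simp [E]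
  have huE : Uniform E r := by
    intro s hs
    have h1 := hu _ ((hE s).1 hs)
    rw [Subtype.val_injective.encard_image, Set.encard_coe_eq_coe_finsetCard] at h1
    exact_mod_cast h1
  have hlE : Linear E := by
    intro s hs t ht x hx y hy hx' hy' hxy
    exact hφ (hl x x.2 y y.2 (fun h => hxy (Subtype.ext h)) _ ((hE s).1 hs) _ ((hE t).1 ht)
      ((hmem s x).2 hx) ((hmem s y).2 hy) ((hmem t x).2 hx') ((hmem t y).2 hy'))
  have hexE : ∀ x y : V(H), x ≠ y → ∃ s ∈ E, x ∈ s ∧ y ∈ s := by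
    intro x y hxy
    obtain ⟨e, ⟨he, hx, hy⟩, -⟩ := hex x x.2 y y.2 (fun h => hxy (Subtype.ext h))
    have hes : φ (Finset.univ.filter fun v : V(H) => (v : α) ∈ e) = e := by
      ext a
      simp only [φ, Finset.coe_filter, Finset.mem_univ, true_and, Set.mem_image, Subtype.exists]
      exact ⟨by rintro ⟨b, hb, hbe, rfl⟩; exact hbe,
        fun ha => ⟨a, Hypergraph.mem_vertexSet_of_mem_edgeSet he ha, ha, rfl⟩⟩
    refine ⟨Finset.univ.filter fun v : V(H) => (v : α) ∈ e, (hE _).2 (hes.symm ▸ he), ?_, ?_⟩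
    · simpa using hx
    · simpa using hy
  let χ' : Finset V(H) → Fin c := fun s =>
    if h : φ s ∈ E(H) then χ ⟨φ s, h⟩ else Classical.choice hc
  obtain ⟨F, hF, hFk, hFs, i, hi⟩ := exists_monochromatic_sparse (k := k) (r := r)
    (by rwa [Fintype.card_fin]) huE hlE hexE χ' (by rw [Fintype.card_fin]; omega)
  refine ⟨φ '' F, ⟨?_, ?_, ?_⟩, i, ?_⟩
  · rintro _ ⟨s, hs, rfl⟩
    exact (hE s).1 (hF hs)
  · rw [hφ.encard_image, Set.encard_coe_eq_coe_finsetCard, hFk]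
  · have h1 : ⋃₀ (φ '' F) = φ (vertexSpan F) := by
      ext a
      simp only [φ, Set.mem_sUnion, Set.mem_image, vertexSpan, Finset.mem_coe,
        Finset.mem_biUnion, id]
      constructor
      · rintro ⟨_, ⟨s, hs, rfl⟩, x, hx, rfl⟩
        exact ⟨x, ⟨s, hs, hx⟩, rfl⟩
      · rintro ⟨x, ⟨s, hs, hx⟩, rfl⟩
        exact ⟨_, ⟨s, hs, rfl⟩, x, hx, rfl⟩
    rw [h1, Subtype.val_injective.encard_image, Set.encard_coe_eq_coe_finsetCard]
    exact_mod_cast hFs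
  · rintro ⟨e, he⟩ ⟨s, hs, rfl⟩
    have := hi s hs
    simpa only [χ', dif_pos he] using this
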